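/- **Theorem 4.1.** Let $h_1,\dots,h_n\in\mathbb{Z}^d$ be nonzero vectors such that the $d\times n$ matrix $(h_1,\dots,h_n)$ has rank $d$ and all its $d\times d$ minors lie in $\{0,1,-1\}$. Let $\mathcal{C}=\{H_1,\dots,H_n\}$ be the central hyperplane arrangement in $\mathbb{R}^d$ with $H_i=\{v: h_i\cdot v=0\}$, and let $L$ be its intersection lattice, that is, the set of all intersections of subfamilies of $\mathcal{C}$ (including $\mathbb{R}^d$), ordered by reverse inclusion, with Möbius function $\mu_L$ and maximum $\hat 1=H_1\cap\dots\cap H_n$. Let $\widetilde{\mathcal{C}}$ be the infinite arrangement of all hyperplanes $H_{ij}=\{v: h_i\cdot v=j\}$ with $1\le i\le n$, $j\in\mathbb{Z}$. Its (relatively open) cells are the classes of points of $\mathbb{R}^d$ that have the same position (on, or on which side) with respect to every $H_{ij}$. The cells of the unimodular toric arrangement $\widetilde{\mathcal{C}}/\mathbb{Z}^d$ are the images of these cells in the torus $\mathbb{R}^d/\mathbb{Z}^d$. Then for each $i$ the number $f_i=f_i(\widetilde{\mathcal{C}}/\mathbb{Z}^d)$ of images of $i$-dimensional cells is finite, and $$\sum_{i=0}^d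 f_i(\widetilde{\mathcal{C}}/\mathbb{Z}^d)\, q^i \;=\; \psi_{\mathcal{C}}(q),$$ where $\psi_{\mathcal{C}}(q)=\sum_{F\in L}|\mu_L(F,\hat 1)|\,q^{\operatorname{corank}F}$ is the cocharacteristic polynomial of $\mathcal{C}$; here $\operatorname{corank} F$ is the corank of the corresponding flat of the matroid of $h_1,\dots,h_n$, i.e. $\operatorname{corank}F=\dim F-\dim\hat 1$. Moreover $$\psi_{\mathcal{C}}(q)\;=\;\sum_{F\in L}\mu_L(F,\hat 1)\,(-q)^{\dim F}.$$ -/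

import Mathlib

open Polynomial

namespace ToricArrangement

noncomputable section

/-- The value `h i · v` of the linear form with integral coefficient vector `h i` at `v ∈ ℝ^d`. -/
def form {d n : ℕ} (h : Fin n → Fin d → ℤ) (i : Fin n) : (Fin d → ℝ) →ₗ[ℝ] ℝ :=
  ∑ k, (h i k : ℝ) • LinearMap.proj k

theorem form_apply {d n : ℕ} (h : Fin n → Fin d → ℤ) (i : Fin n) (v : Fin d → ℝ) :
    form h i v = ∑ k, (h i k : ℝ) * v k := by
  simp [form]

/-! ### The central arrangement and its intersection lattice -/

/-- The linear hyperplane `H_i = {v | h_i · v = 0}` (a hyperplane as soon as `h i ≠ 0`). -/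
def hyperplane {d n : ℕ} (h : Fin n → Fin d → ℤ) (i : Fin n) : Submodule ℝ (Fin d → ℝ) :=
  LinearMap.ker (form h i)

/-- Unimodularity: the `d × n` matrix `(h_1, …, h_n)` has rank `d` and all its `d × d` minors
lie in `{0, 1, -1}`. (Column selections `s` with repetitions give `0`, and reordering the columns
changes only the sign, so that quantifying over all `s` is the same as over all minors.) -/
structure IsUnimodular {d n : ℕ} (h : Fin n → Fin d → ℤ) : Prop where
  rank_eq : ((Matrix.of h).transpose.map (fun z : ℤ => (z : ℝ))).rank = d
  minors : ∀ s : Fin d → Fin n,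
    ((Matrix.of h).transpose.submatrix id s).det ∈ ({0, 1, -1} : Set ℤ)

/-- The intersection lattice `L`: all intersections of subfamilies of `H_1, …, H_n`, including the
empty intersection `ℝ^d`. The order dual makes the order *reverse* inclusion. -/
def IntersectionLattice {d n : ℕ} (h : Fin n → Fin d → ℤ) : Type :=
  {F : (Submodule ℝ (Fin d → ℝ))ᵒᵈ // ∃ S : Set (Fin n), OrderDual.ofDual F = ⨅ i ∈ S, hyperplane h i}

namespace IntersectionLattice

variable {d n : ℕ} {h : Fin n → Fin d → ℤ}

/-- The linear subspace underlying an element of `L`. -/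
def toSubmodule (F : IntersectionLattice h) : Submodule ℝ (Fin d → ℝ) :=
  OrderDual.ofDual F.1

/-- The dimension of an element of `L` as a linear subspace. -/
def dim (F : IntersectionLattice h) : ℕ :=
  Module.finrank ℝ F.toSubmodule

instance : PartialOrder (IntersectionLattice h) :=
  Subtype.partialOrder _

theorem le_iff (F G : IntersectionLattice h) : F ≤ G ↔ G.toSubmodule ≤ F.toSubmodule :=
  Iff.rfl

/-- The maximum `1̂` of `L` is the intersection of all hyperplanes. -/
instance : OrderTop (IntersectionLattice h) where
  top := ⟨OrderDual.toDual (⨅ i ∈ (Set.univ : Set (Fin n)), hyperplane h i), Set.univ, rfl⟩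
  le_top F := by
    obtain ⟨S, hS⟩ := F.2
    change (⨅ i ∈ (Set.univ : Set (Fin n)), hyperplane h i) ≤ OrderDual.ofDual F.1
    rw [hS]
    exact biInf_mono fun i _ => Set.mem_univ i

instance : Finite (IntersectionLattice h) :=
  Finite.of_surjective
    (fun S : Set (Fin n) =>
      (⟨OrderDual.toDual (⨅ i ∈ S, hyperplane h i), S, rfl⟩ : IntersectionLattice h))
    (fun F => by
      obtain ⟨S, hS⟩ := F.2
      exact ⟨S, Subtype.ext hS.symm⟩)

instance : Fintype (IntersectionLattice h) := Fintype.ofFinite _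

instance : DecidableEq (IntersectionLattice h) := Classical.decEq _

instance : LocallyFiniteOrder (IntersectionLattice h) :=
  @Fintype.toLocallyFiniteOrder _ _ _ (Classical.decRel _) (Classical.decRel _)

/-- The Möbius function `μ_L(F, 1̂)`. -/
def mobius (F : IntersectionLattice h) : ℤ :=
  IncidenceAlgebra.mu ℤ F ⊤

/-- The corank of the flat given by `F`, in the matroid of `h_1, …, h_n`: the rank of a
flat is the codimension of `F`, and the rank of the matroid is the codimension of `1̂`. -/
def corank (F : IntersectionLattice h) : ℕ :=
  (d - (⊤ : IntersectionLattice h).dim) - (d - F.dim)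

end IntersectionLattice

/-- The cocharacteristic polynomial `ψ(q) = ∑_F |μ_L(F, 1̂)| q^{corank F}` of the arrangement. -/
def cocharPoly {d n : ℕ} (h : Fin n → Fin d → ℤ) : ℤ[X] :=
  ∑ F : IntersectionLattice h, C |F.mobius| * X ^ F.corank

/-! ### The infinite arrangement and the toric arrangement -/

/-- The (relatively open) cell through `x` of the infinite arrangement of all integral translates
`H_{ij} = {v | h_i · v = j}`, `j ∈ ℤ`: the points that lie on the same side of (or, like `x`, on)
each of the hyperplanes `H_{ij}`. -/
def cellThrough {d n : ℕ} (h : Fin n → Fin d → ℤ) (x : Fin d → ℝ) : Set (Fin d → ℝ) :=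
  {y | ∀ (i : Fin n) (j : ℤ), SignType.sign (form h i y - j) = SignType.sign (form h i x - j)}

/-- The cells of the infinite arrangement in `ℝ^d`. -/
def cells {d n : ℕ} (h : Fin n → Fin d → ℤ) : Set (Set (Fin d → ℝ)) :=
  Set.range (cellThrough h)

/-- The dimension of a subset of `ℝ^d`: that of its affine span. -/
def setDim {d : ℕ} (c : Set (Fin d → ℝ)) : ℕ :=
  Module.finrank ℝ (vectorSpan ℝ c)

/-- The lattice `ℤ^d` in `ℝ^d`. -/
def intLattice (d : ℕ) : AddSubgroup (Fin d → ℝ) :=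
  ((Int.castAddHom ℝ).compLeft (Fin d)).range

/-- The torus `𝕋^d = ℝ^d / ℤ^d`. -/
abbrev Torus (d : ℕ) : Type :=
  (Fin d → ℝ) ⧸ intLattice d

/-- The `i`-dimensional cells of the toric arrangement: the images in the torus of the
`i`-dimensional cells of the infinite arrangement. -/
def toricCells {d n : ℕ} (h : Fin n → Fin d → ℤ) (i : ℕ) : Set (Set (Torus d)) :=
  {t | ∃ c ∈ cells h, setDim c = i ∧ t = (QuotientAddGroup.mk : (Fin d → ℝ) → Torus d) '' c}

/-- The number `f_i` of `i`-dimensional cells of the toric arrangement. -/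
def fNumber {d n : ℕ} (h : Fin n → Fin d → ℤ) (i : ℕ) : ℕ :=
  (toricCells h i).ncard

end

end ToricArrangement

/-! For a flat `F` let N(F) be the number of toric cells with direction space `F`. The theorem
reduces to μ(F, 1̂) = (-1)^{dim F} N(F): summing N(F) over the flats of dimension i gives f_i, and
taking absolute values gives ψ. The rank condition makes 1̂ the zero space, so corank is dimension.

By Möbius inversion it suffices that, for every `G`, the sum of (-1)^{dim F} N(F) over the flats `F`
contained in `G` is 1 if `G` = 0 and 0 otherwise; this is the Euler characteristic of a torus of
dimension dim `G`. Unimodularity gives a lattice basis of forms from the family, some of which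
(those in `W`) cut out `G`. If a cell has direction inside `G`, the forms in `W` are integral on it
(`IsUnimodular.form_mem_int`), so a lattice translate of it lies in the half-open cube where the
coordinates in `W` vanish and the others run over [0, 1). Distinct cells in this cube stay distinct
in the torus, so the sum equals an alternating sum over the cells of a finite affine arrangement in
the cube.

Such a sum is unchanged when a hyperplane is added (`eulerSum_insert`): a cell that is properly cut
becomes two pieces of its own dimension and one of dimension one less. Hence only the walls of the
cube matter, and each free coordinate contributes a point and an open interval, that is, a factor 1
- 1 = 0. -/

namespace ToricArrangement

/-! ### Euler sums of finite affine arrangements -/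

section EulerSum

variable {V ι : Type*} [AddCommGroup V] [Module ℝ V] (φ : ι → Module.Dual ℝ V) (c : ι → ℝ)

open Classical in
/-- The position of `x` with respect to the hyperplanes `φ i = c i`, for `i ∈ s`. -/
noncomputable def signVec (s : Finset ι) (x : V) : ι → SignType :=
  fun i => if i ∈ s then SignType.sign (φ i x - c i) else 0

/-- The direction space of a cell with sign vector `τ`. -/
def dirSpace (s : Finset ι) (τ : ι → SignType) : Submodule ℝ V :=
  ⨅ i ∈ {i | i ∈ s ∧ τ i = 0}, LinearMap.ker (φ i)

variable {φ c}

theorem mem_dirSpace {s : Finset ι} {τ : ι → SignType} {v : V} :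
    v ∈ dirSpace φ s τ ↔ ∀ i ∈ s, τ i = 0 → φ i v = 0 := by
  simp [dirSpace, Submodule.mem_iInf]

theorem signVec_eq_iff {s : Finset ι} {x y : V} :
    signVec φ c s x = signVec φ c s y ↔
      ∀ i ∈ s, SignType.sign (φ i x - c i) = SignType.sign (φ i y - c i) := by
  constructor
  · intro h i hi
    simpa [signVec, hi] using congrFun h i
  · intro h
    funext i
    by_cases hi : i ∈ s
    · simpa [signVec, hi] using h i hi
    · simp [signVec, hi]

theorem mem_dirSpace_signVec {s : Finset ι} {x v : V} :
    v ∈ dirSpace φ s (signVec φ c s x) ↔ ∀ i ∈ s, φ i x = c i → φ i v = 0 := by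
  rw [mem_dirSpace]
  refine forall₂_congr fun i hi => ?_
  simp [signVec, hi, sub_eq_zero]

theorem finite_signVec_image (s : Finset ι) (P : Set V) : (signVec φ c s '' P).Finite := by
  classical
  -- Sign vectors are 0 off `s`, so restricting them to `s` loses nothing.
  refine Set.Finite.of_finite_image (f := fun τ (i : s) => τ i) (Set.toFinite _) ?_
  rintro _ ⟨x, -, rfl⟩ _ ⟨y, -, rfl⟩ h
  rw [signVec_eq_iff]
  intro i hi
  simpa [signVec, hi] using congrFun h ⟨i, hi⟩

theorem sign_convexComb {a b t : ℝ} (h : SignType.sign a = SignType.sign b) (h0 : 0 ≤ t)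
    (h1 : t ≤ 1) : SignType.sign (a + t * (b - a)) = SignType.sign a := by
  rcases h1.eq_or_lt with rfl | h1
  · simp [h]
  rw [show a + t * (b - a) = (1 - t) * a + t * b by ring]
  have h1' : 0 < 1 - t := by linarith
  rcases lt_trichotomy a 0 with ha | ha | ha
  · rw [sign_neg ha, eq_comm, sign_eq_neg_one_iff] at h
    rw [sign_neg ha, sign_eq_neg_one_iff]
    exact add_neg_of_neg_of_nonpos (mul_neg_of_pos_of_neg h1' ha)
      (mul_nonpos_of_nonneg_of_nonpos h0 h.le)
  · subst ha
    rw [sign_zero, eq_comm, sign_eq_zero_iff] at h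
    simp [h]
  · rw [sign_pos ha, eq_comm, sign_eq_one_iff] at h
    rw [sign_pos ha, sign_eq_one_iff]
    positivity

/-- Cells are convex. -/
theorem signVec_convexComb {s : Finset ι} {x y : V} (h : signVec φ c s x = signVec φ c s y)
    {t : ℝ} (h0 : 0 ≤ t) (h1 : t ≤ 1) :
    signVec φ c s (x + t • (y - x)) = signVec φ c s x := by
  rw [signVec_eq_iff] at h ⊢
  intro i hi
  have := sign_convexComb (h i hi) h0 h1
  rw [← this]
  congr 1
  simp only [map_add, map_smul, map_sub, smul_eq_mul]
  ring

/-- Cells are relatively open. -/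
theorem exists_signVec_add_smul_eq {s : Finset ι} {x v : V}
    (hv : v ∈ dirSpace φ s (signVec φ c s x)) :
    ∃ δ > 0, ∀ t : ℝ, |t| < δ → signVec φ c s (x + t • v) = signVec φ c s x := by
  rw [mem_dirSpace_signVec] at hv
  -- Strict inequalities survive small `t` by continuity; equalities survive because `v` lies in
  -- those kernels.
  have key : ∀ᶠ t : ℝ in nhds 0, ∀ i ∈ s,
      SignType.sign (φ i (x + t • v) - c i) = SignType.sign (φ i x - c i) := by
    rw [Filter.eventually_all_finset]
    intro i hi
    simp only [map_add, map_smul, smul_eq_mul]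
    have hc : Filter.Tendsto (fun t : ℝ => φ i x + t * φ i v - c i) (nhds 0)
        (nhds (φ i x - c i)) := by
      have : Continuous (fun t : ℝ => φ i x + t * φ i v - c i) := by fun_prop
      simpa using this.tendsto 0
    rcases lt_trichotomy (φ i x - c i) 0 with h | h | h
    · filter_upwards [hc.eventually_lt_const h] with t ht
      rw [sign_neg ht, sign_neg h]
    · simp [hv i hi (sub_eq_zero.1 h)]
    · filter_upwards [hc.eventually_const_lt h] with t ht
      rw [sign_pos ht, sign_pos h]
  obtain ⟨δ, hδ, H⟩ := Metric.eventually_nhds_iff.1 key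
  refine ⟨δ, hδ, fun t ht => ?_⟩
  rw [signVec_eq_iff]
  exact H (by simpa using ht)

theorem sub_mem_dirSpace {s : Finset ι} {x y : V} (h : signVec φ c s y = signVec φ c s x) :
    y - x ∈ dirSpace φ s (signVec φ c s x) := by
  rw [mem_dirSpace_signVec]
  rw [signVec_eq_iff] at h
  intro i hi hx
  have := h i hi
  rw [hx, sub_self, sign_zero, sign_eq_zero_iff, sub_eq_zero] at this
  rw [map_sub, hx, this, sub_self]

theorem finrank_inf_ker [FiniteDimensional ℝ V] (W : Submodule ℝ V) (f : Module.Dual ℝ V)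
    (h : ¬ W ≤ LinearMap.ker f) :
    Module.finrank ℝ (W ⊓ LinearMap.ker f : Submodule ℝ V) + 1 = Module.finrank ℝ W := by
  have h1 := (f.domRestrict W).finrank_range_add_finrank_ker
  have hne : f.domRestrict W ≠ 0 := by
    intro h0
    apply h
    intro w hw
    exact LinearMap.congr_fun h0 ⟨w, hw⟩
  rw [LinearMap.range_eq_top.2 (LinearMap.surjective hne), finrank_top, Module.finrank_self] at h1
  have h2 : Module.finrank ℝ (LinearMap.ker (f.domRestrict W)) =
      Module.finrank ℝ (W ⊓ LinearMap.ker f : Submodule ℝ V) := by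
    rw [LinearMap.ker_domRestrict, ← Submodule.finrank_map_subtype_eq,
      Submodule.map_comap_subtype]
  omega

/-- The signs that a further hyperplane takes on a cell: all three if it cuts the cell properly,
and one otherwise. The pieces have the same Euler sum as the cell. -/
theorem sum_pieces [FiniteDimensional ℝ V] (s : Finset ι) (a : ι) (x : V) (R : Finset SignType)
    (hR : ∀ ε, ε ∈ R ↔ ∃ y, signVec φ c s y = signVec φ c s x ∧ SignType.sign (φ a y - c a) = ε) :
    ∑ ε ∈ R, (-1 : ℤ) ^ Module.finrank ℝ
      (if ε = 0 then dirSpace φ s (signVec φ c s x) ⊓ LinearMap.ker (φ a)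
        else dirSpace φ s (signVec φ c s x) : Submodule ℝ V) =
      (-1) ^ Module.finrank ℝ (dirSpace φ s (signVec φ c s x)) := by
  by_cases hle : dirSpace φ s (signVec φ c s x) ≤ LinearMap.ker (φ a)
  · have : R = {SignType.sign (φ a x - c a)} := by
      ext ε
      rw [hR, Finset.mem_singleton]
      constructor
      · rintro ⟨y, hy, rfl⟩
        have := hle (sub_mem_dirSpace hy)
        rw [LinearMap.mem_ker, map_sub, sub_eq_zero] at this
        rw [this]
      · rintro rfl
        exact ⟨x, rfl, rfl⟩
    rw [this, Finset.sum_singleton, inf_eq_left.2 hle, ite_self]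
  -- If the cell meets the hyperplane at `y`, moving from `y` both ways along a transversal `v`
  -- yields all three signs. Otherwise convexity forbids two opposite signs.
  · by_cases h0 : (0 : SignType) ∈ R
    · obtain ⟨y, hy, hy0⟩ := (hR 0).1 h0
      obtain ⟨v, hv, hva⟩ := SetLike.not_le_iff_exists.1 hle
      rw [LinearMap.mem_ker] at hva
      rw [sign_eq_zero_iff] at hy0
      rw [← hy] at hv
      obtain ⟨δ, hδ, H⟩ := exists_signVec_add_smul_eq hv
      have hval : ∀ t : ℝ, φ a (y + t • v) - c a = t * φ a v := by
        intro t
        simp only [map_add, map_smul, smul_eq_mul]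
        linarith
      have hall : R = {0, -1, 1} := by
        ext ε
        have hmem : ∀ t : ℝ, |t| < δ → SignType.sign (t * φ a v) ∈ R := fun t ht =>
          (hR _).2 ⟨y + t • v, (H t ht).trans hy, by rw [hval]⟩
        have hp := hmem (δ / 2) (by rw [abs_of_pos (by linarith)]; linarith)
        have hm := hmem (-(δ / 2)) (by rw [abs_neg, abs_of_pos (by linarith)]; linarith)
        rw [sign_mul, sign_pos (by linarith : (0 : ℝ) < δ / 2), one_mul] at hp
        rw [sign_mul, sign_neg (by linarith : -(δ / 2) < (0 : ℝ))] at hm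
        rcases lt_or_gt_of_ne hva with h | h
        · rw [sign_neg h] at hp hm
          rcases ε with _ | _ | _
          · simpa using h0
          · simpa using hp
          · simpa using hm
        · rw [sign_pos h] at hp hm
          rcases ε with _ | _ | _
          · simpa using h0
          · simpa using hm
          · simpa using hp
      have hd := finrank_inf_ker _ _ hle
      rw [hall, Finset.sum_insert (by decide), Finset.sum_insert (by decide),
        Finset.sum_singleton, if_pos rfl, if_neg (by decide), if_neg (by decide), ← hd, pow_succ]
      ring
    · have hno : ¬ ((-1 : SignType) ∈ R ∧ (1 : SignType) ∈ R) := by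
        rintro ⟨h1, h2⟩
        obtain ⟨y, hy, hy1⟩ := (hR _).1 h1
        obtain ⟨z, hz, hz1⟩ := (hR _).1 h2
        rw [sign_eq_neg_one_iff] at hy1
        rw [sign_eq_one_iff] at hz1
        set p := φ a y - c a with hp
        set q := φ a z - c a with hq
        have hpq : 0 < q - p := by linarith
        apply h0
        -- The parameter is the zero of the affine function going from `p < 0` to `q > 0`.
        refine (hR 0).2 ⟨y + (-p / (q - p)) • (z - y), ?_, ?_⟩
        · rw [signVec_convexComb (hy.trans hz.symm) (div_nonneg (by linarith) hpq.le), hy]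
          rw [div_le_one hpq]
          linarith
        · rw [sign_eq_zero_iff]
          simp only [map_add, map_smul, map_sub, smul_eq_mul]
          have : φ a z - φ a y = q - p := by rw [hp, hq]; ring
          rw [this, div_mul_cancel₀ _ hpq.ne']
          rw [hp]; ring
      have hx : SignType.sign (φ a x - c a) ∈ R := (hR _).2 ⟨x, rfl, rfl⟩
      have hx0 : SignType.sign (φ a x - c a) ≠ 0 := fun h => h0 (h ▸ hx)
      have : R = {SignType.sign (φ a x - c a)} := by
        revert h0 hno hx hx0
        generalize SignType.sign (φ a x - c a) = e
        clear hR
        revert R e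
        decide
      rw [this, Finset.sum_singleton, if_neg hx0]

variable (φ c) in
/-- The alternating sum over the cells that meet `P`. -/
noncomputable def eulerSum (s : Finset ι) (P : Set V) : ℤ :=
  ∑ τ ∈ (finite_signVec_image (φ := φ) (c := c) s P).toFinset,
    (-1) ^ Module.finrank ℝ (dirSpace φ s τ)

/-- Group the new cells by the old cell containing them. Since `P` is a union of old cells, each
group consists of all pieces of one cell, and `sum_pieces` applies. -/
theorem eulerSum_insert [FiniteDimensional ℝ V] [DecidableEq ι] {s : Finset ι} {a : ι} {P : Set V}
    (ha : a ∉ s) (hP : ∀ x ∈ P, ∀ y, signVec φ c s y = signVec φ c s x → y ∈ P) :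
    eulerSum φ c (insert a s) P = eulerSum φ c s P := by
  have hproj : ∀ x, Function.update (signVec φ c (insert a s) x) a 0 = signVec φ c s x := by
    intro x
    funext i
    by_cases hi : i = a
    · subst hi
      simp [signVec, ha]
    · simp [signVec, hi]
  have hlift : ∀ x, signVec φ c (insert a s) x =
      Function.update (signVec φ c s x) a (SignType.sign (φ a x - c a)) := by
    intro x
    funext i
    by_cases hi : i = a
    · subst hi
      simp [signVec]
    · simp [signVec, hi]
  unfold eulerSum
  classical
  -- Resetting coordinate `a` to the default 0 forgets the new hyperplane.
  rw [← Finset.sum_fiberwise_of_maps_to (g := fun τ => Function.update τ a 0)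
    (t := (finite_signVec_image (φ := φ) (c := c) s P).toFinset)]
  swap
  · intro τ hτ
    rw [Set.Finite.mem_toFinset] at hτ ⊢
    obtain ⟨x, hx, rfl⟩ := hτ
    exact ⟨x, hx, (hproj x).symm⟩
  refine Finset.sum_congr rfl fun τ hτ => ?_
  rw [Set.Finite.mem_toFinset] at hτ
  obtain ⟨x, hx, rfl⟩ := hτ
  rw [← sum_pieces s a x (Finset.univ.filter fun ε =>
    ∃ y, signVec φ c s y = signVec φ c s x ∧ SignType.sign (φ a y - c a) = ε) (by simp)]
  symm
  refine Finset.sum_nbij (fun ε => Function.update (signVec φ c s x) a ε) ?_ ?_ ?_ ?_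
  · intro ε hε
    simp only [Finset.mem_filter, Finset.mem_univ, true_and] at hε
    obtain ⟨y, hy, rfl⟩ := hε
    simp only [Finset.mem_filter, Set.Finite.mem_toFinset]
    refine ⟨⟨y, hP x hx y hy, by rw [hlift, hy]⟩, ?_⟩
    rw [← hy, ← hlift, hproj]
  · intro ε _ ε' _ h
    simpa using congrFun h a
  · intro τ hτ
    simp only [Finset.coe_filter, Set.Finite.mem_toFinset, Set.mem_ofPred_eq] at hτ
    obtain ⟨⟨y, -, rfl⟩, hy⟩ := hτ
    rw [hproj] at hy
    refine ⟨SignType.sign (φ a y - c a), ?_, ?_⟩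
    · simp only [Finset.coe_filter, Finset.mem_univ, true_and, Set.mem_ofPred_eq]
      exact ⟨y, hy, rfl⟩
    · simp only
      rw [hlift, hy]
  · intro ε _
    have hmem : ∀ v, v ∈ dirSpace φ (insert a s) (Function.update (signVec φ c s x) a ε) ↔
        v ∈ dirSpace φ s (signVec φ c s x) ∧ (ε = 0 → φ a v = 0) := by
      intro v
      simp only [mem_dirSpace, Finset.mem_insert, forall_eq_or_imp, Function.update_self]
      rw [and_comm]
      refine and_congr_left fun _ => forall₂_congr fun i hi => ?_
      rw [Function.update_of_ne (ne_of_mem_of_not_mem hi ha)]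
    have heq : dirSpace φ (insert a s) (Function.update (signVec φ c s x) a ε) =
        if ε = 0 then dirSpace φ s (signVec φ c s x) ⊓ LinearMap.ker (φ a)
          else dirSpace φ s (signVec φ c s x) := by
      ext v
      rw [hmem]
      by_cases hε : ε = 0 <;> simp [hε]
    rw [heq]

/-- The Euler sum does not change when the arrangement is refined. -/
theorem eulerSum_eq_of_subset [FiniteDimensional ℝ V] {s₀ s : Finset ι} {P : Set V}
    (hs : s₀ ⊆ s) (hP : ∀ x ∈ P, ∀ y, signVec φ c s₀ y = signVec φ c s₀ x → y ∈ P) :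
    eulerSum φ c s P = eulerSum φ c s₀ P := by
  classical
  suffices H : ∀ t : Finset ι, Disjoint t s₀ → eulerSum φ c (t ∪ s₀) P = eulerSum φ c s₀ P by
    rw [← H (s \ s₀) Finset.sdiff_disjoint, Finset.sdiff_union_of_subset hs]
  intro t
  induction t using Finset.induction_on with
  | empty => simp
  | insert a t ha ih =>
    intro hd
    rw [Finset.disjoint_insert_left] at hd
    rw [Finset.insert_union, eulerSum_insert, ih hd.2]
    · simp [ha, hd.1]
    · intro x hx y hy
      refine hP x hx y ?_
      rw [signVec_eq_iff] at hy ⊢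
      exact fun i hi => hy i (Finset.mem_union_right _ hi)

end EulerSum

end ToricArrangement

namespace ToricArrangement

/-! ### Unimodular bases -/

section Basis

variable {d n : ℕ} {h : Fin n → Fin d → ℤ}

/-- A basis of a unimodular arrangement, adapted to a subfamily `S`: it is a basis of the lattice,
and its members indexed by `W` lie in `S` and generate `S`. -/
theorem IsUnimodular.exists_adapted_basis (hu : IsUnimodular h) (S : Set (Fin n)) :
    ∃ (b : Fin d → Fin n) (W : Finset (Fin d)) (a : Fin n → Fin d → ℤ)
      (e : (Fin d → ℝ) ≃ₗ[ℝ] (Fin d → ℝ)),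
      (∀ k ∈ W, b k ∈ S) ∧ (∀ i j, h i j = ∑ k, a i k * h (b k) j) ∧
      (∀ i ∈ S, ∀ k ∉ W, a i k = 0) ∧ (∀ x k, e x k = form h (b k) x) ∧
      (∀ z : Fin d → ℤ, ∃ w : Fin d → ℤ, e (fun j => (w j : ℝ)) = fun k => (z k : ℝ)) := by
  classical
  set v : Fin n → Fin d → ℝ := fun i j => (h i j : ℝ) with hv
  -- Extending in two stages, first inside `S` and then to the whole family, makes `B₀` span `S`.
  obtain ⟨B₀, hB₀S, -, hspan₀, hli₀⟩ :=
    exists_linearIndepOn_extension (linearIndepOn_empty ℝ v) (Set.empty_subset S)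
  obtain ⟨B, -, hB₀B, hspan, hli⟩ := exists_linearIndepOn_extension hli₀ (Set.subset_univ B₀)
  have htop : Submodule.span ℝ (v '' B) = ⊤ := by
    have h1 : Module.finrank ℝ (Submodule.span ℝ (Set.range v)) = d := by
      have := hu.rank_eq
      rwa [Matrix.rank_eq_finrank_span_cols] at this
    have h2 : Submodule.span ℝ (Set.range v) = ⊤ :=
      Submodule.eq_top_of_finrank_eq (by rw [h1, Module.finrank_fin_fun])
    rw [eq_top_iff, ← h2, Submodule.span_le, ← Set.image_univ]
    exact hspan
  have hcard : Fintype.card B = d := by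
    have h1 := finrank_span_eq_card hli.linearIndependent
    have h2 : Set.range (fun i : B => v i) = v '' B := by
      rw [Set.image_eq_range]
    rw [h2, htop, finrank_top, Module.finrank_fin_fun] at h1
    exact h1.symm
  let f : Fin d ≃ B := (Fintype.equivFinOfCardEq hcard).symm
  let b : Fin d → Fin n := fun k => f k
  have hlib : LinearIndependent ℝ (fun k => v (b k)) :=
    hli.linearIndependent.comp f f.injective
  let A : Matrix (Fin d) (Fin d) ℤ := Matrix.of fun k j => h (b k) j
  let AR : Matrix (Fin d) (Fin d) ℝ := A.map (Int.castRingHom ℝ)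
  have hAR : IsUnit AR := Matrix.linearIndependent_rows_iff_isUnit.1 hlib
  -- A nonzero minor is 1 or -1, so `A` is invertible over ℤ; hence coordinates in this basis are
  -- integral.
  have hdet : IsUnit A.det := by
    have h1 : AR.det ≠ 0 := ((Matrix.isUnit_iff_isUnit_det _).1 hAR).ne_zero
    have h2 : AR.det = (A.det : ℝ) := by
      exact (RingHom.map_det (Int.castRingHom ℝ) A).symm
    have h3 : A.det ≠ 0 := by
      intro h0
      rw [h2, h0] at h1
      simp at h1
    have h4 : A.det ∈ ({0, 1, -1} : Set ℤ) := by
      have := hu.minors b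
      rwa [← Matrix.det_transpose] at this
    rcases h4 with h4 | h4 | h4
    · exact absurd h4 h3
    · rw [h4]; exact isUnit_one
    · rw [Set.mem_singleton_iff.1 h4]; exact isUnit_one.neg
  let W : Finset (Fin d) := Finset.univ.filter fun k => b k ∈ B₀
  let a : Fin n → Fin d → ℤ := fun i => Matrix.vecMul (h i) A⁻¹
  have ha : ∀ i j, h i j = ∑ k, a i k * h (b k) j := by
    intro i j
    have : Matrix.vecMul (a i) A = h i := by
      simp only [a]
      rw [Matrix.vecMul_vecMul, Matrix.nonsing_inv_mul _ hdet, Matrix.vecMul_one]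
    conv_lhs => rw [← this]
    rfl
  have hinv1 : AR * (A⁻¹).map (Int.castRingHom ℝ) = 1 := by
    rw [← Matrix.map_mul, Matrix.mul_nonsing_inv _ hdet]
    simp
  have hinv2 : (A⁻¹).map (Int.castRingHom ℝ) * AR = 1 := by
    rw [← Matrix.map_mul, Matrix.nonsing_inv_mul _ hdet]
    simp
  refine ⟨b, W, a, Matrix.toLin'OfInv hinv2 hinv1, ?_, ha, ?_, ?_, ?_⟩
  · intro k hk
    exact hB₀S (Finset.mem_filter.1 hk).2
  · intro i hi k hk
    have h1 : v i ∈ Submodule.span ℝ ((fun k => v (b k)) '' (W : Set (Fin d))) := by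
      have h2 : (fun k => v (b k)) '' (W : Set (Fin d)) = v '' B₀ := by
        ext y
        constructor
        · rintro ⟨k, hk, rfl⟩
          exact ⟨b k, (Finset.mem_filter.1 hk).2, rfl⟩
        · rintro ⟨i, hi, rfl⟩
          have hfi : b (f.symm ⟨i, hB₀B hi⟩) = i := by simp [b]
          exact ⟨f.symm ⟨i, hB₀B hi⟩, by simp [W, hfi, hi], by simp only [hfi]⟩
      rw [h2]
      exact hspan₀ ⟨i, hi, rfl⟩
    obtain ⟨l, hl, hl2⟩ := (Finsupp.mem_span_image_iff_linearCombination ℝ).1 h1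
    -- Uniqueness of coordinates: the integral ones agree with the real ones `l`, which are
    -- supported on `W`.
    have h3 : ∑ k, ((a i k : ℝ) - l k) • v (b k) = 0 := by
      have h4 : ∑ k, l k • v (b k) = v i := by
        rw [← hl2, Finsupp.linearCombination_apply, Finsupp.sum_fintype]
        simp
      have h5 : ∑ k, (a i k : ℝ) • v (b k) = v i := by
        ext j
        simp only [Finset.sum_apply, Pi.smul_apply, smul_eq_mul, hv]
        rw [ha i j]
        push_cast
        rfl
      simp only [sub_smul, Finset.sum_sub_distrib]
      rw [h4, h5, sub_self]
    have h6 := Fintype.linearIndependent_iff.1 hlib _ h3 k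
    have h7 : l k = 0 := by
      by_contra h0
      exact hk (hl (Finsupp.mem_support_iff.2 h0))
    rw [h7, sub_zero] at h6
    exact_mod_cast h6
  · intro x k
    rw [form_apply]
    rfl
  · intro z
    refine ⟨Matrix.mulVec A⁻¹ z, ?_⟩
    have : Matrix.mulVec A (Matrix.mulVec A⁻¹ z) = z := by
      rw [Matrix.mulVec_mulVec, Matrix.mul_nonsing_inv _ hdet, Matrix.one_mulVec]
    funext k
    have hk := congrFun this k
    conv_rhs => rw [← hk]
    change ∑ j, (A k j : ℝ) * _ = ((∑ j, A k j * _ : ℤ) : ℝ)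
    push_cast
    rfl

theorem form_eq_sum {b : Fin d → Fin n} {a : Fin n → Fin d → ℤ}
    (ha : ∀ i j, h i j = ∑ k, a i k * h (b k) j) (i : Fin n) (x : Fin d → ℝ) :
    form h i x = ∑ k, (a i k : ℝ) * form h (b k) x := by
  simp only [form_apply, Finset.mul_sum]
  rw [Finset.sum_comm]
  refine Finset.sum_congr rfl fun j _ => ?_
  rw [ha i j]
  push_cast
  rw [Finset.sum_mul]
  exact Finset.sum_congr rfl fun k _ => by ring

/-- If `h j` vanishes on the intersection of the hyperplanes in `S`, then `h j` is an integral
combination of `S`. -/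
theorem IsUnimodular.form_mem_int (hu : IsUnimodular h) {S : Set (Fin n)} {j : Fin n}
    (hj : ⨅ i ∈ S, hyperplane h i ≤ hyperplane h j) {x : Fin d → ℝ}
    (hx : ∀ i ∈ S, ∃ m : ℤ, form h i x = m) : ∃ m : ℤ, form h j x = m := by
  obtain ⟨b, W, a, e, hbW, ha, haS, he, -⟩ := hu.exists_adapted_basis S
  have hz : ∀ k ∉ W, a j k = 0 := by
    intro k hk
    -- The dual basis vector at `k` reads off the coefficient `a i k` of each form. For `k ∉ W` it
    -- is killed by `S`, hence by `h j`.
    have hb : ∀ k', form h (b k') (e.symm (Pi.single k 1)) = if k' = k then 1 else 0 := by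
      intro k'
      rw [← he, LinearEquiv.apply_symm_apply, Pi.single_apply]
    have hf : ∀ i, form h i (e.symm (Pi.single k 1)) = a i k := by
      intro i
      rw [form_eq_sum ha]
      simp [hb]
    have : e.symm (Pi.single k 1) ∈ hyperplane h j := by
      apply hj
      simp only [Submodule.mem_iInf]
      intro i hi
      rw [hyperplane, LinearMap.mem_ker, hf, haS i hi k hk, Int.cast_zero]
    rw [hyperplane, LinearMap.mem_ker, hf] at this
    exact_mod_cast this
  have : ∀ k, ∃ m : ℤ, (a j k : ℝ) * form h (b k) x = m := by
    intro k
    by_cases hk : k ∈ W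
    · obtain ⟨m, hm⟩ := hx _ (hbW k hk)
      exact ⟨a j k * m, by rw [hm]; push_cast; rfl⟩
    · exact ⟨0, by rw [hz k hk]; simp⟩
  choose m hm using this
  exact ⟨∑ k, m k, by rw [form_eq_sum ha]; push_cast; exact Finset.sum_congr rfl fun k _ => hm k⟩

/-- Dimension of the common kernel of part of a system of coordinates. -/
theorem finrank_iInf_ker_coord {b : Fin d → Fin n} {e : (Fin d → ℝ) ≃ₗ[ℝ] (Fin d → ℝ)}
    (he : ∀ x k, e x k = form h (b k) x) (U : Submodule ℝ (Fin d → ℝ)) (W : Finset (Fin d))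
    (hU : ∀ x, x ∈ U ↔ ∀ k ∈ W, form h (b k) x = 0) :
    Module.finrank ℝ U = Wᶜ.card := by
  have h1 : U = (⨅ k ∈ (W : Set (Fin d)), LinearMap.ker
      (LinearMap.proj k : (Fin d → ℝ) →ₗ[ℝ] ℝ)).comap (e : (Fin d → ℝ) →ₗ[ℝ] (Fin d → ℝ)) := by
    ext x
    simp [hU, Submodule.mem_iInf, he]
  rw [h1, LinearEquiv.finrank_eq (e.submoduleMap _), Submodule.map_comap_eq_of_surjective
    e.surjective]
  rw [LinearEquiv.finrank_eq (LinearMap.iInfKerProjEquiv ℝ (fun _ : Fin d => ℝ)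
    (I := ((Wᶜ : Finset (Fin d)) : Set (Fin d))) (J := (W : Set (Fin d))) ?_ ?_)]
  · rw [Module.finrank_fintype_fun_eq_card]
    simp [Finset.compl_eq_univ_sdiff, Finset.sdiff_eq_filter]
  · rw [Finset.disjoint_coe]
    exact disjoint_compl_left
  · intro k _
    by_cases hk : k ∈ W <;> simp

end Basis

end ToricArrangement

namespace ToricArrangement

/-! ### Cells and their direction spaces -/

section Cells

variable {d n : ℕ} {h : Fin n → Fin d → ℤ}

theorem cellThrough_eq_iff {x y : Fin d → ℝ} :
    cellThrough h x = cellThrough h y ↔ ∀ (i : Fin n) (j : ℤ),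
      SignType.sign (form h i x - j) = SignType.sign (form h i y - j) := by
  constructor
  · intro hxy
    have : x ∈ cellThrough h x := fun _ _ => rfl
    rw [hxy] at this
    exact this
  · intro hxy
    ext z
    exact forall₂_congr fun i j => by rw [hxy]

theorem mem_cellThrough_self (x : Fin d → ℝ) : x ∈ cellThrough h x := fun _ _ => rfl

theorem mem_cellThrough_iff {x y : Fin d → ℝ} :
    y ∈ cellThrough h x ↔ cellThrough h y = cellThrough h x :=
  cellThrough_eq_iff.symm

variable (h) in
/-- The direction space of the cell through `x`, as an element of the intersection lattice. -/
noncomputable def direction (x : Fin d → ℝ) : IntersectionLattice h :=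
  ⟨OrderDual.toDual (⨅ i ∈ {i | ∃ j : ℤ, form h i x = j}, hyperplane h i), _, rfl⟩

theorem mem_direction {x v : Fin d → ℝ} :
    v ∈ (direction h x).toSubmodule ↔ ∀ i, (∃ j : ℤ, form h i x = j) → form h i v = 0 := by
  change v ∈ (⨅ i ∈ {i | ∃ j : ℤ, form h i x = j}, hyperplane h i) ↔ _
  simp only [Submodule.mem_iInf, hyperplane, LinearMap.mem_ker]
  rfl

theorem IntersectionLattice.ext_submodule {F G : IntersectionLattice h}
    (hFG : F.toSubmodule = G.toSubmodule) : F = G :=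
  Subtype.ext hFG

theorem direction_congr {x y : Fin d → ℝ}
    (hxy : ∀ i, (∃ j : ℤ, form h i x = j) ↔ ∃ j : ℤ, form h i y = j) :
    direction h x = direction h y := by
  apply IntersectionLattice.ext_submodule
  ext v
  simp only [mem_direction, hxy]

theorem direction_eq_of_cellThrough_eq {x y : Fin d → ℝ}
    (hxy : cellThrough h x = cellThrough h y) : direction h x = direction h y := by
  rw [cellThrough_eq_iff] at hxy
  refine direction_congr fun i => exists_congr fun j => ?_
  rw [← sub_eq_zero, ← sign_eq_zero_iff, hxy, sign_eq_zero_iff, sub_eq_zero]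

/-- Replaces the conditions from infinitely many parallel hyperplanes by a single open one. -/
theorem sign_sub_intCast_eq {a b : ℝ} (ha : ∀ j : ℤ, a ≠ j) (hb : b ∈ Set.Ioo (⌊a⌋ : ℝ) (⌊a⌋ + 1))
    (j : ℤ) : SignType.sign (b - j) = SignType.sign (a - j) := by
  rcases lt_or_ge ⌊a⌋ j with hj | hj
  · have h1 : (⌊a⌋ : ℝ) + 1 ≤ j := by exact_mod_cast hj
    rw [sign_neg (by linarith [hb.2]), sign_neg (by linarith [Int.lt_floor_add_one a])]
  · have h1 : (j : ℝ) ≤ ⌊a⌋ := by exact_mod_cast hj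
    have h2 : (j : ℝ) < a := lt_of_le_of_ne (h1.trans (Int.floor_le a)) (ha j).symm
    rw [sign_pos (by linarith [hb.1]), sign_pos (by linarith)]

/-- The cell is relatively open in the affine subspace fixed by the forms that are integral at `x`.
-/
theorem vectorSpan_cellThrough (x : Fin d → ℝ) :
    vectorSpan ℝ (cellThrough h x) = (direction h x).toSubmodule := by
  apply le_antisymm
  · rw [vectorSpan_def, Submodule.span_le]
    rintro _ ⟨y, hy, z, hz, rfl⟩
    rw [SetLike.mem_coe, mem_direction]
    rintro i ⟨j, hj⟩
    have key : ∀ w ∈ cellThrough h x, form h i w = j := by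
      intro w hw
      have := hw i j
      rwa [hj, sub_self, sign_zero, sign_eq_zero_iff, sub_eq_zero] at this
    change form h i (y - z) = 0
    rw [map_sub, key y hy, key z hz, sub_self]
  · intro v hv
    rw [mem_direction] at hv
    have key : ∀ᶠ t : ℝ in nhds 0, ∀ i, ∀ j : ℤ,
        SignType.sign (form h i (x + t • v) - j) = SignType.sign (form h i x - j) := by
      rw [Filter.eventually_all]
      intro i
      simp only [map_add, map_smul, smul_eq_mul]
      by_cases hi : ∃ j : ℤ, form h i x = j
      · simp [hv i hi]
      · push Not at hi
        have hc : Filter.Tendsto (fun t : ℝ => form h i x + t * form h i v) (nhds 0)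
            (nhds (form h i x)) := by
          have : Continuous (fun t : ℝ => form h i x + t * form h i v) := by fun_prop
          simpa using this.tendsto 0
        have hmem : Set.Ioo (⌊form h i x⌋ : ℝ) (⌊form h i x⌋ + 1) ∈ nhds (form h i x) :=
          Ioo_mem_nhds (lt_of_le_of_ne (Int.floor_le _) (hi _).symm) (Int.lt_floor_add_one _)
        filter_upwards [hc hmem] with t ht
        exact sign_sub_intCast_eq hi ht
    obtain ⟨δ, hδ, H⟩ := Metric.eventually_nhds_iff.1 key
    have hd : δ / 2 ≠ 0 := by positivity
    have h1 : x + (δ / 2) • v ∈ cellThrough h x :=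
      H (by rw [Real.dist_eq, sub_zero, abs_of_pos (by positivity)]; linarith)
    have h2 := vsub_mem_vectorSpan ℝ h1 (mem_cellThrough_self x)
    rw [vsub_eq_sub, add_sub_cancel_left] at h2
    have := Submodule.smul_mem _ (δ / 2)⁻¹ h2
    rwa [smul_smul, inv_mul_cancel₀ hd, one_smul] at this

theorem setDim_cellThrough (x : Fin d → ℝ) :
    setDim (cellThrough h x) = (direction h x).dim := by
  rw [setDim, vectorSpan_cellThrough]
  rfl

/-! ### Translations by the lattice -/

theorem mem_intLattice_iff {z : Fin d → ℝ} :
    z ∈ intLattice d ↔ ∃ w : Fin d → ℤ, z = fun k => (w k : ℝ) := by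
  constructor
  · rintro ⟨w, rfl⟩
    exact ⟨w, rfl⟩
  · rintro ⟨w, rfl⟩
    exact ⟨w, rfl⟩

theorem exists_form_eq_intCast {z : Fin d → ℝ} (hz : z ∈ intLattice d) (i : Fin n) :
    ∃ m : ℤ, form h i z = m := by
  obtain ⟨w, rfl⟩ := mem_intLattice_iff.1 hz
  exact ⟨∑ k, h i k * w k, by rw [form_apply]; push_cast; rfl⟩

theorem direction_add {z : Fin d → ℝ} (hz : z ∈ intLattice d) (x : Fin d → ℝ) :
    direction h (x + z) = direction h x := by
  refine direction_congr fun i => ?_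
  obtain ⟨m, hm⟩ := exists_form_eq_intCast (h := h) hz i
  rw [map_add, hm]
  constructor
  · rintro ⟨j, hj⟩
    exact ⟨j - m, by push_cast; linarith⟩
  · rintro ⟨j, hj⟩
    exact ⟨j + m, by push_cast; linarith⟩

theorem add_mem_cellThrough {z : Fin d → ℝ} (hz : z ∈ intLattice d) {x y : Fin d → ℝ}
    (hy : y ∈ cellThrough h x) : y + z ∈ cellThrough h (x + z) := by
  intro i j
  obtain ⟨m, hm⟩ := exists_form_eq_intCast (h := h) hz i
  have := hy i (j - m)
  push_cast at this
  rw [map_add, map_add, hm]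
  convert this using 2 <;> ring

variable (h) in
/-- The image in the torus of the cell through `x`. -/
def toricCell (x : Fin d → ℝ) : Set (Torus d) :=
  (QuotientAddGroup.mk : (Fin d → ℝ) → Torus d) '' cellThrough h x

/-- Lattice translations shift every form by an integer, so they permute the cells; where the class
of the one point `x` lies already determines the translate. -/
theorem toricCell_eq_iff {x y : Fin d → ℝ} :
    toricCell h x = toricCell h y ↔ ∃ z ∈ intLattice d, cellThrough h x = cellThrough h (y + z) := by
  have hsub : ∀ {x y z : Fin d → ℝ}, z ∈ intLattice d → cellThrough h x = cellThrough h (y + z) →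
      toricCell h y ⊆ toricCell h x := by
    rintro x y z hz hxy _ ⟨w, hw, rfl⟩
    refine ⟨w + z, hxy ▸ add_mem_cellThrough hz hw, ?_⟩
    rw [eq_comm, QuotientAddGroup.eq]
    simpa using hz
  constructor
  · intro hxy
    have : (QuotientAddGroup.mk x : Torus d) ∈ toricCell h y :=
      hxy ▸ ⟨x, mem_cellThrough_self x, rfl⟩
    obtain ⟨w, hw, hwx⟩ := this
    rw [QuotientAddGroup.eq] at hwx
    refine ⟨-w + x, hwx, ?_⟩
    have := add_mem_cellThrough hwx hw
    rw [add_neg_cancel_left] at this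
    exact mem_cellThrough_iff.1 this
  · rintro ⟨z, hz, hxy⟩
    refine Set.Subset.antisymm (hsub (neg_mem hz) ?_) (hsub hz hxy)
    have h1 : x + -z ∈ cellThrough h (y + z + -z) :=
      add_mem_cellThrough (neg_mem hz) (mem_cellThrough_iff.2 hxy)
    rw [add_neg_cancel_right] at h1
    exact (mem_cellThrough_iff.1 h1).symm

theorem toricCell_add {z : Fin d → ℝ} (hz : z ∈ intLattice d) (x : Fin d → ℝ) :
    toricCell h (x + z) = toricCell h x :=
  toricCell_eq_iff.2 ⟨z, hz, rfl⟩

theorem direction_eq_of_toricCell_eq {x y : Fin d → ℝ} (hxy : toricCell h x = toricCell h y) :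
    direction h x = direction h y := by
  obtain ⟨z, hz, hxy⟩ := toricCell_eq_iff.1 hxy
  rw [direction_eq_of_cellThrough_eq hxy, direction_add hz]

/-- The toric cells with direction space `F`. -/
def toricCellsOver (F : IntersectionLattice h) : Set (Set (Torus d)) :=
  toricCell h '' {x | direction h x = F}

theorem toricCells_eq_biUnion (i : ℕ) :
    toricCells h i = ⋃ F ∈ (Finset.univ.filter fun F : IntersectionLattice h => F.dim = i),
      toricCellsOver F := by
  ext t
  simp only [Set.mem_iUnion, Finset.mem_filter, Finset.mem_univ, true_and, exists_prop]
  constructor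
  · rintro ⟨_, ⟨x, rfl⟩, hd, rfl⟩
    exact ⟨direction h x, by rw [← setDim_cellThrough, hd], x, rfl, rfl⟩
  · rintro ⟨F, hF, x, hx, rfl⟩
    refine ⟨_, ⟨x, rfl⟩, ?_, rfl⟩
    rw [setDim_cellThrough, ← hF, ← hx]

theorem toricCellsOver_disjoint {F G : IntersectionLattice h} (hFG : F ≠ G) :
    Disjoint (toricCellsOver F) (toricCellsOver G) := by
  rw [Set.disjoint_left]
  rintro _ ⟨x, hx, rfl⟩ ⟨y, hy, hxy⟩
  exact hFG (hx.symm.trans ((direction_eq_of_toricCell_eq hxy).symm.trans hy))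

end Cells

end ToricArrangement

namespace ToricArrangement

/-! ### Counting the toric cells with a given direction space -/

/-- Used to count images in the torus through sign vectors, which induce the same equivalence
relation on the cube. -/
theorem ncard_image_congr {α β γ : Type*} {f : α → β} {g : α → γ} {A : Set α}
    (H : ∀ x ∈ A, ∀ y ∈ A, f x = f y ↔ g x = g y) : (f '' A).ncard = (g '' A).ncard := by
  refine Set.ncard_congr (fun t ht => g ht.choose) ?_ ?_ ?_
  · intro t ht
    exact ⟨_, ht.choose_spec.1, rfl⟩
  · intro t t' ht ht' htt
    rw [← ht.choose_spec.2, ← ht'.choose_spec.2]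
    exact (H _ ht.choose_spec.1 _ ht'.choose_spec.1).2 htt
  · rintro _ ⟨x, hx, rfl⟩
    have ht : f x ∈ f '' A := ⟨x, hx, rfl⟩
    exact ⟨f x, ht, (H _ ht.choose_spec.1 _ hx).1 ht.choose_spec.2⟩

theorem finite_image_congr {α β γ : Type*} {f : α → β} {g : α → γ} {A : Set α}
    (H : ∀ x ∈ A, ∀ y ∈ A, g x = g y → f x = f y) (hg : (g '' A).Finite) : (f '' A).Finite := by
  rcases A.eq_empty_or_nonempty with rfl | ⟨a, -⟩
  · simp
  have : Nonempty α := ⟨a⟩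
  refine (hg.image fun t => f (Function.invFunOn g A t)).subset ?_
  rintro _ ⟨x, hx, rfl⟩
  have hgx : g x ∈ g '' A := ⟨x, hx, rfl⟩
  exact ⟨g x, hgx, H _ (Function.invFunOn_mem hgx) _ hx (Function.invFunOn_eq hgx)⟩

section Count

variable {d n : ℕ} {h : Fin n → Fin d → ℤ}

variable (h) in
/-- The linear part of the equation of the hyperplane `H_{ij}`. -/
noncomputable abbrev translateForm (p : Fin n × ℤ) : Module.Dual ℝ (Fin d → ℝ) := form h p.1

variable (n) in
/-- The constant term of the equation of the hyperplane `H_{ij}`. -/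
abbrev translateConst (p : Fin n × ℤ) : ℝ := p.2

/-- The indices of the hyperplanes `H_{ij}` with `|j| ≤ M`. -/
noncomputable def window (n : ℕ) (M : ℤ) : Finset (Fin n × ℤ) := Finset.univ ×ˢ Finset.Icc (-M) M

theorem mem_window {M : ℤ} {i : Fin n} {j : ℤ} : (i, j) ∈ window n M ↔ |j| ≤ M := by
  simp [window, abs_le]

/-- Hyperplanes with |j| > M miss the region where all forms are bounded by `M`, so they separate
none of its points. -/
theorem signVec_window_eq_iff {M : ℤ} {x y : Fin d → ℝ} (hx : ∀ i, |form h i x| ≤ M)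
    (hy : ∀ i, |form h i y| ≤ M) :
    signVec (translateForm h) (translateConst n) (window n M) x =
      signVec (translateForm h) (translateConst n) (window n M) y ↔
      cellThrough h x = cellThrough h y := by
  rw [signVec_eq_iff, cellThrough_eq_iff]
  constructor
  · intro H i j
    by_cases hj : |j| ≤ M
    · exact H (i, j) (mem_window.2 hj)
    · have h1 := abs_le.1 (hx i)
      have h2 := abs_le.1 (hy i)
      rw [abs_le, not_and_or, not_le, not_le] at hj
      rcases hj with hj | hj
      · have h3 : (j : ℝ) < -M := by exact_mod_cast hj
        rw [sign_pos (by linarith), sign_pos (by linarith)]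
      · have h3 : (M : ℝ) < j := by exact_mod_cast hj
        rw [sign_neg (by linarith), sign_neg (by linarith)]
  · rintro H ⟨i, j⟩ -
    exact H i j

theorem dirSpace_window {M : ℤ} {x : Fin d → ℝ} (hx : ∀ i, |form h i x| ≤ M) :
    dirSpace (translateForm h) (window n M)
      (signVec (translateForm h) (translateConst n) (window n M) x) =
      (direction h x).toSubmodule := by
  ext v
  rw [mem_dirSpace_signVec, mem_direction]
  constructor
  · rintro H i ⟨j, hj⟩
    refine H (i, j) (mem_window.2 ?_) hj
    have := hx i
    rw [hj] at this
    exact_mod_cast this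
  · rintro H ⟨i, j⟩ - hj
    exact H i ⟨j, hj⟩

/-- The half-open cube in the coordinates `e`, intersected with the coordinate subspace on which
the coordinates in `W` vanish. -/
def halfOpenCube (e : (Fin d → ℝ) ≃ₗ[ℝ] (Fin d → ℝ)) (W : Finset (Fin d)) : Set (Fin d → ℝ) :=
  {x | (∀ k, 0 ≤ e x k ∧ e x k < 1) ∧ ∀ k ∈ W, e x k = 0}

/-- The indices of the hyperplanes that bound the half-open cube. -/
def cubeWalls (b : Fin d → Fin n) : Finset (Fin n × ℤ) :=
  Finset.univ.image (fun k => (b k, 0)) ∪ Finset.univ.image (fun k => (b k, 1))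

theorem forall_mem_cubeWalls {b : Fin d → Fin n} {p : Fin n × ℤ → Prop} :
    (∀ q ∈ cubeWalls b, p q) ↔ ∀ k, p (b k, 0) ∧ p (b k, 1) := by
  simp only [cubeWalls, Finset.mem_union, Finset.mem_image, Finset.mem_univ, true_and]
  constructor
  · intro H k
    exact ⟨H _ (Or.inl ⟨k, rfl⟩), H _ (Or.inr ⟨k, rfl⟩)⟩
  · rintro H q (⟨k, rfl⟩ | ⟨k, rfl⟩)
    · exact (H k).1
    · exact (H k).2

variable {b : Fin d → Fin n} {e : (Fin d → ℝ) ≃ₗ[ℝ] (Fin d → ℝ)}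

theorem signVec_cubeWalls_eq_iff (he : ∀ x k, e x k = form h (b k) x) {x y : Fin d → ℝ} :
    signVec (translateForm h) (translateConst n) (cubeWalls b) x =
      signVec (translateForm h) (translateConst n) (cubeWalls b) y ↔
      ∀ k, SignType.sign (e x k) = SignType.sign (e y k) ∧
        SignType.sign (e x k - 1) = SignType.sign (e y k - 1) := by
  rw [signVec_eq_iff, forall_mem_cubeWalls]
  simp [translateConst, translateForm, he]

/-- The cube is defined by comparisons with 0 and 1 only, so it is a union of cells of its walls, as
`eulerSum_eq_of_subset` requires. -/
theorem mem_halfOpenCube_of_signVec_eq (he : ∀ x k, e x k = form h (b k) x)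
    {W : Finset (Fin d)} {x : Fin d → ℝ} (hx : x ∈ halfOpenCube e W) {y : Fin d → ℝ}
    (hxy : signVec (translateForm h) (translateConst n) (cubeWalls b) y =
      signVec (translateForm h) (translateConst n) (cubeWalls b) x) : y ∈ halfOpenCube e W := by
  rw [signVec_cubeWalls_eq_iff he] at hxy
  refine ⟨fun k => ⟨?_, ?_⟩, fun k hk => ?_⟩
  · rw [← sign_nonneg_iff, (hxy k).1, sign_nonneg_iff]
    exact (hx.1 k).1
  · rw [← sub_neg, ← sign_eq_neg_one_iff, (hxy k).2, sign_eq_neg_one_iff, sub_neg]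
    exact (hx.1 k).2
  · rw [← sign_eq_zero_iff, (hxy k).1, sign_eq_zero_iff]
    exact hx.2 k hk

/-- The Euler sum of a half-open cube. -/
theorem eulerSum_halfOpenCube (he : ∀ x k, e x k = form h (b k) x) (W : Finset (Fin d)) :
    eulerSum (translateForm h) (translateConst n) (cubeWalls b) (halfOpenCube e W) =
      if Wᶜ = ∅ then 1 else 0 := by
  classical
  rw [← Finset.sum_powerset_neg_one_pow_card, eulerSum]
  -- Cells of the cube correspond to sets `Y` of free coordinates lying in (0, 1), the rest being 0;
  -- `pt Y` is a sample point of a cell of dimension |Y|.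
  let pt : Finset (Fin d) → Fin d → ℝ := fun Y => e.symm fun k => if k ∈ Y then 1 / 2 else 0
  have hpt : ∀ Y k, e (pt Y) k = if k ∈ Y then 1 / 2 else 0 := by
    intro Y k
    simp only [pt, LinearEquiv.apply_symm_apply]
  symm
  refine Finset.sum_nbij
    (fun Y => signVec (translateForm h) (translateConst n) (cubeWalls b) (pt Y)) ?_ ?_ ?_ ?_
  · intro Y hY
    rw [Finset.mem_powerset] at hY
    rw [Set.Finite.mem_toFinset]
    refine ⟨pt Y, ⟨fun k => ?_, fun k hk => ?_⟩, rfl⟩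
    · rw [hpt]
      split_ifs <;> norm_num
    · rw [hpt, if_neg]
      exact fun hkY => Finset.mem_compl.1 (hY hkY) hk
  · intro Y _ Y' _ hYY
    simp only at hYY
    rw [signVec_cubeWalls_eq_iff he] at hYY
    ext k
    have := (hYY k).1
    rw [hpt, hpt] at this
    by_cases h1 : k ∈ Y <;> by_cases h2 : k ∈ Y' <;> simp [h1, h2] at this ⊢
  · intro τ hτ
    rw [Finset.mem_coe, Set.Finite.mem_toFinset] at hτ
    obtain ⟨x, hx, rfl⟩ := hτ
    refine ⟨Finset.univ.filter fun k => e x k ≠ 0, ?_, ?_⟩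
    · rw [Finset.mem_coe, Finset.mem_powerset]
      intro k hk
      rw [Finset.mem_compl]
      exact fun hkW => (Finset.mem_filter.1 hk).2 (hx.2 k hkW)
    · simp only
      rw [signVec_cubeWalls_eq_iff he]
      intro k
      rw [hpt, sign_neg (sub_neg.2 (hx.1 k).2)]
      by_cases hk : e x k = 0
      · simp [hk]
      · have : 0 < e x k := lt_of_le_of_ne (hx.1 k).1 (Ne.symm hk)
        rw [sign_pos this, if_pos (by simpa using hk), sign_pos (by norm_num), sign_neg (by norm_num)]
        exact ⟨rfl, rfl⟩
  · intro Y _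
    rw [finrank_iInf_ker_coord he _ Yᶜ, compl_compl]
    intro v
    rw [mem_dirSpace_signVec, forall_mem_cubeWalls]
    refine forall_congr' fun k => ?_
    simp only [translateConst, translateForm, ← he, hpt]
    by_cases hk : k ∈ Y <;> simp [hk]

/-- Every point with integral coordinates in `W` has a lattice translate in the half-open cube. -/
theorem exists_add_mem_halfOpenCube
    (hw : ∀ z : Fin d → ℤ, ∃ w : Fin d → ℤ, e (fun j => (w j : ℝ)) = fun k => (z k : ℝ))
    {W : Finset (Fin d)} {x : Fin d → ℝ} (hx : ∀ k ∈ W, ∃ m : ℤ, e x k = m) :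
    ∃ z ∈ intLattice d, x + z ∈ halfOpenCube e W := by
  -- This translation replaces each coordinate by its fractional part.
  obtain ⟨w, hw⟩ := hw fun k => -⌊e x k⌋
  have key : ∀ k, e (x + fun j => (w j : ℝ)) k = Int.fract (e x k) := by
    intro k
    rw [map_add, Pi.add_apply, hw, Int.fract]
    push_cast
    ring
  refine ⟨_, mem_intLattice_iff.2 ⟨w, rfl⟩, fun k => ?_, fun k hk => ?_⟩
  · rw [key]
    exact ⟨Int.fract_nonneg _, Int.fract_lt_one _⟩
  · obtain ⟨m, hm⟩ := hx k hk
    rw [key, hm, Int.fract_intCast]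

/-- Different cells in the half-open cube have different images in the torus. -/
theorem toricCell_eq_iff_of_mem_halfOpenCube (he : ∀ x k, e x k = form h (b k) x)
    {W : Finset (Fin d)} {x y : Fin d → ℝ} (hx : x ∈ halfOpenCube e W)
    (hy : y ∈ halfOpenCube e W) :
    toricCell h x = toricCell h y ↔ cellThrough h x = cellThrough h y := by
  refine ⟨fun hxy => ?_, fun hxy => by rw [toricCell, hxy, toricCell]⟩
  obtain ⟨z, hz, hxy⟩ := toricCell_eq_iff.1 hxy
  suffices hz0 : z = 0 by rwa [hz0, add_zero] at hxy
  rw [cellThrough_eq_iff] at hxy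
  apply e.injective
  rw [map_zero]
  funext k
  obtain ⟨m, hm⟩ := exists_form_eq_intCast (h := h) hz (b k)
  -- Comparison with 0 and 1 puts the coordinates of `y + z` in [0, 1) too, so the integer `m` lies
  -- strictly between -1 and 1.
  have h0 := hxy (b k) 0
  have h1 := hxy (b k) 1
  have hm0 := hxy (b k) m
  have hm1 := hxy (b k) (m + 1)
  push_cast at h0 h1 hm0 hm1
  rw [map_add, ← he, ← he, ← he] at h0 h1 hm0 hm1
  rw [← he] at hm
  rw [hm] at h0 h1 hm0 hm1 ⊢
  have hx' := hx.1 k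
  have hy' := hy.1 k
  have e1 : (0 : SignType) ≤ SignType.sign (e x k - 0) := by
    rw [sign_nonneg_iff]; linarith
  rw [h0, sign_nonneg_iff] at e1
  have e2 : SignType.sign (e x k - 1) = -1 := by
    rw [sign_eq_neg_one_iff]; linarith
  rw [h1, sign_eq_neg_one_iff] at e2
  have e3 : (-1 : ℝ) < m := by linarith
  have e4 : (m : ℝ) < 1 := by linarith
  have e5 : (-1 : ℤ) < m := by exact_mod_cast e3
  have e6 : m < (1 : ℤ) := by exact_mod_cast e4
  have : m = 0 := by omega
  simp [this]

theorem mem_top_iff {x : Fin d → ℝ} :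
    x ∈ (⊤ : IntersectionLattice h).toSubmodule ↔ ∀ i, form h i x = 0 := by
  change x ∈ (⨅ i ∈ (Set.univ : Set (Fin n)), hyperplane h i) ↔ _
  simp [Submodule.mem_iInf, hyperplane]

theorem IsUnimodular.dim_top (hu : IsUnimodular h) : (⊤ : IntersectionLattice h).dim = 0 := by
  obtain ⟨b, W, a, e, -, ha, -, he, -⟩ := hu.exists_adapted_basis Set.univ
  rw [IntersectionLattice.dim, finrank_iInf_ker_coord he _ Finset.univ]
  · simp
  · intro x
    rw [mem_top_iff]
    refine ⟨fun H k _ => H _, fun H i => ?_⟩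
    rw [form_eq_sum ha]
    exact Finset.sum_eq_zero fun k hk => by rw [H k hk, mul_zero]

/-- The toric cells with direction space contained in `G` decompose a torus of dimension `dim G`,
so their alternating sum is `0` unless `dim G = 0`. -/
theorem IsUnimodular.sum_ncard_toricCellsOver (hu : IsUnimodular h) (G : IntersectionLattice h) :
    (∀ F, G ≤ F → (toricCellsOver F).Finite) ∧
    ∑ F ∈ Finset.Ici G, (-1 : ℤ) ^ F.dim * ((toricCellsOver F).ncard : ℤ) =
      if G = ⊤ then 1 else 0 := by
  classical
  obtain ⟨S, hS⟩ := G.2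
  obtain ⟨b, W, a, e, hbW, ha, haS, he, hlat⟩ := hu.exists_adapted_basis S
  have hG : ∀ x, x ∈ G.toSubmodule ↔ ∀ k ∈ W, form h (b k) x = 0 := by
    intro x
    have h1 : x ∈ G.toSubmodule ↔ ∀ i ∈ S, form h i x = 0 := by
      rw [IntersectionLattice.toSubmodule, hS]
      simp [Submodule.mem_iInf, hyperplane]
    rw [h1]
    refine ⟨fun H k hk => H _ (hbW k hk), fun H i hi => ?_⟩
    rw [form_eq_sum ha]
    refine Finset.sum_eq_zero fun k _ => ?_
    by_cases hk : k ∈ W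
    · rw [H k hk, mul_zero]
    · rw [haS i hi k hk, Int.cast_zero, zero_mul]
  have hGtop : G = ⊤ ↔ Wᶜ = ∅ := by
    have hdim : G.dim = Wᶜ.card := finrank_iInf_ker_coord he _ W hG
    constructor
    · rintro rfl
      rw [hu.dim_top] at hdim
      exact Finset.card_eq_zero.1 hdim.symm
    · intro hW
      apply IntersectionLattice.ext_submodule
      have hbot : ∀ F : IntersectionLattice h, F.dim = 0 → F.toSubmodule = ⊥ := fun F hF =>
        Submodule.finrank_eq_zero.1 hF
      rw [hbot G (by rw [hdim, hW, Finset.card_empty]), hbot ⊤ hu.dim_top]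
  set P := halfOpenCube e W with hP
  -- The coefficient sum bounds every form on the cube, where coordinates lie in [0, 1); the extra 1
  -- puts the walls at level 1 inside the window.
  set M : ℤ := 1 + ∑ i, ∑ k, |a i k| with hM
  have hM1 : 1 ≤ M := by
    have : 0 ≤ ∑ i, ∑ k, |a i k| :=
      Finset.sum_nonneg fun i _ => Finset.sum_nonneg fun k _ => abs_nonneg _
    omega
  have hbound : ∀ x ∈ P, ∀ i, |form h i x| ≤ M := by
    intro x hx i
    have h1 : |form h i x| ≤ ((∑ k, |a i k| : ℤ) : ℝ) := by
      rw [form_eq_sum ha]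
      refine (Finset.abs_sum_le_sum_abs _ _).trans ?_
      push_cast
      refine Finset.sum_le_sum fun k _ => ?_
      rw [abs_mul, ← he]
      refine mul_le_of_le_one_right (abs_nonneg _) ?_
      rw [abs_of_nonneg (hx.1 k).1]
      exact (hx.1 k).2.le
    have h2 : ∑ k, |a i k| ≤ ∑ i, ∑ k, |a i k| :=
      Finset.single_le_sum (f := fun i => ∑ k, |a i k|)
        (fun i _ => Finset.sum_nonneg fun k _ => abs_nonneg _) (Finset.mem_univ i)
    refine h1.trans ?_
    exact_mod_cast h2.trans (by omega)
  have hsub : cubeWalls b ⊆ window n M := by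
    intro q
    revert q
    rw [forall_mem_cubeWalls]
    intro k
    rw [mem_window, mem_window]
    exact ⟨by simp; omega, by simpa using hM1⟩
  set σ := signVec (translateForm h) (translateConst n) (window n M) with hσ
  have hσcell : ∀ x ∈ P, ∀ y ∈ P, toricCell h x = toricCell h y ↔ σ x = σ y := by
    intro x hx y hy
    rw [signVec_window_eq_iff (hbound x hx) (hbound y hy),
      toricCell_eq_iff_of_mem_halfOpenCube he hx hy]
  -- The forms in `W` vanish on `F`, so they are integral combinations of forms integral at `x`;
  -- this allows translation into the cube.
  have hover : ∀ F, G ≤ F → toricCellsOver F = toricCell h '' {x ∈ P | direction h x = F} := by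
    intro F hF
    apply Set.Subset.antisymm
    · rintro _ ⟨x, rfl, rfl⟩
      obtain ⟨z, hz, hxz⟩ := exists_add_mem_halfOpenCube (W := W) hlat (x := x) (by
        intro k hk
        rw [he]
        refine hu.form_mem_int (S := {i | ∃ j : ℤ, form h i x = j}) ?_ fun i hi => hi
        intro v hv
        exact (hG v).1 (hF hv) k hk)
      exact ⟨x + z, ⟨hxz, direction_add hz x⟩, toricCell_add hz x⟩
    · exact Set.image_mono fun x hx => hx.2
  have hfin : (σ '' P).Finite := finite_signVec_image _ _
  refine ⟨fun F hF => ?_, ?_⟩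
  · rw [hover F hF]
    exact finite_image_congr (fun x hx y hy => (hσcell x hx.1 y hy.1).2)
      (hfin.subset (Set.image_mono fun x hx => hx.1))
  -- On the cube the sign vector determines the direction; `⊤` is a dummy value for vectors not
  -- attained.
  · have hm : ∀ τ, ∃ F, ∀ x ∈ P, σ x = τ → direction h x = F := by
      intro τ
      by_cases hτ : ∃ x ∈ P, σ x = τ
      · obtain ⟨x, hx, rfl⟩ := hτ
        exact ⟨direction h x, fun y hy hyx =>
          direction_eq_of_toricCell_eq ((hσcell y hy x hx).2 hyx)⟩
      · exact ⟨⊤, fun x hx hxτ => (hτ ⟨x, hx, hxτ⟩).elim⟩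
    choose m hm using hm
    have hcount : ∀ F, G ≤ F →
        (toricCellsOver F).ncard = (hfin.toFinset.filter fun τ => m τ = F).card := by
      intro F hF
      rw [hover F hF, ncard_image_congr (g := σ) fun x hx y hy => hσcell x hx.1 y hy.1,
        ← Set.ncard_coe_finset]
      congr 1
      ext τ
      simp only [Finset.coe_filter, Set.Finite.mem_toFinset, Set.mem_ofPred_eq]
      constructor
      · rintro ⟨x, ⟨hx, rfl⟩, rfl⟩
        exact ⟨⟨x, hx, rfl⟩, (hm _ x hx rfl).symm⟩
      · rintro ⟨⟨x, hx, rfl⟩, rfl⟩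
        exact ⟨x, ⟨hx, hm _ x hx rfl⟩, rfl⟩
    -- Passing from the window to the walls makes the alternating sum computable.
    have heuler := eulerSum_eq_of_subset (φ := translateForm h) (c := translateConst n) hsub
      (P := P) fun x hx y hy => mem_halfOpenCube_of_signVec_eq he hx hy
    rw [eulerSum_halfOpenCube he, ← if_congr hGtop rfl rfl, eulerSum] at heuler
    rw [← heuler, ← Finset.sum_fiberwise_of_maps_to (g := m) (t := Finset.Ici G)]
    · refine Finset.sum_congr rfl fun F hF => ?_
      rw [hcount F (Finset.mem_Ici.1 hF), mul_comm, ← nsmul_eq_mul, ← Finset.sum_const]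
      refine Finset.sum_congr rfl fun τ hτ => ?_
      simp only [Finset.mem_filter, Set.Finite.mem_toFinset] at hτ
      obtain ⟨⟨x, hx, rfl⟩, rfl⟩ := hτ
      rw [← hm _ x hx rfl, dirSpace_window (hbound x hx)]
      rfl
    · intro τ hτ
      rw [Set.Finite.mem_toFinset] at hτ
      obtain ⟨x, hx, rfl⟩ := hτ
      rw [Finset.mem_Ici, ← hm _ x hx rfl, IntersectionLattice.le_iff]
      intro v hv
      rw [hG]
      intro k hk
      refine mem_direction.1 hv _ ⟨0, ?_⟩
      rw [← he, hx.2 k hk, Int.cast_zero]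

end Count

end ToricArrangement

namespace ToricArrangement

/-! ### Möbius inversion and the f-vector -/

section Mobius

variable {d n : ℕ} {h : Fin n → Fin d → ℤ}

/-- Inverting the alternating sums over up-sets, which equal the indicator of `⊤`, leaves the single
term μ(F, 1̂). -/
theorem IsUnimodular.mobius_eq (hu : IsUnimodular h) (F : IntersectionLattice h) :
    F.mobius = (-1) ^ F.dim * ((toricCellsOver F).ncard : ℤ) := by
  have := IncidenceAlgebra.moebius_inversion_top
    (fun F : IntersectionLattice h => (-1 : ℤ) ^ F.dim * ((toricCellsOver F).ncard : ℤ))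
    (fun G => if G = ⊤ then 1 else 0)
    (fun G => by
      rw [← (hu.sum_ncard_toricCellsOver G).2]) F
  rw [this]
  simp [IntersectionLattice.mobius]

theorem IsUnimodular.abs_mobius (hu : IsUnimodular h) (F : IntersectionLattice h) :
    |F.mobius| = ((toricCellsOver F).ncard : ℤ) := by
  rw [hu.mobius_eq, abs_mul, abs_pow, abs_neg, abs_one, one_pow, one_mul, Nat.abs_cast]

theorem IntersectionLattice.dim_le (F : IntersectionLattice h) : F.dim ≤ d := by
  simpa [IntersectionLattice.dim] using Submodule.finrank_le F.toSubmodule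

theorem IsUnimodular.corank_eq_dim (hu : IsUnimodular h) (F : IntersectionLattice h) :
    F.corank = F.dim := by
  have := F.dim_le
  rw [IntersectionLattice.corank, hu.dim_top]
  omega

theorem IsUnimodular.finite_toricCellsOver (hu : IsUnimodular h) (F : IntersectionLattice h) :
    (toricCellsOver F).Finite :=
  (hu.sum_ncard_toricCellsOver F).1 F le_rfl

theorem IsUnimodular.finite_toricCells (hu : IsUnimodular h) (i : ℕ) : (toricCells h i).Finite := by
  rw [toricCells_eq_biUnion]
  exact (Finset.finite_toSet _).biUnion fun F _ => hu.finite_toricCellsOver F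

theorem IsUnimodular.fNumber_eq (hu : IsUnimodular h) (i : ℕ) :
    fNumber h i = ∑ F : IntersectionLattice h with F.dim = i, (toricCellsOver F).ncard := by
  rw [fNumber, toricCells_eq_biUnion, ← finsum_mem_coe_finset]
  exact Set.Finite.ncard_biUnion (Finset.finite_toSet _)
    (fun F _ => hu.finite_toricCellsOver F) fun F _ G _ hFG => toricCellsOver_disjoint hFG

end Mobius

end ToricArrangement

/-- The `f`-vector of a unimodular toric arrangement (with finitely many cells) has as generating
function the cocharacteristic polynomial of the underlying central arrangement, which is
`∑_{F ∈ L} μ_L(F, 1̂) (-q)^{dim F}`. -/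
theorem theorem4p1 (d n : ℕ) (h : Fin n → Fin d → ℤ) (hne : ∀ i, h i ≠ 0)
    (hu : ToricArrangement.IsUnimodular h) :
    (∀ i, (ToricArrangement.toricCells h i).Finite) ∧
    (∑ i ∈ Finset.range (d + 1), C (ToricArrangement.fNumber h i : ℤ) * X ^ i) =
      ToricArrangement.cocharPoly h ∧
    ToricArrangement.cocharPoly h =
      ∑ F : ToricArrangement.IntersectionLattice h, C F.mobius * (-X) ^ F.dim := by
  refine ⟨hu.finite_toricCells, ?_, ?_⟩
  · rw [ToricArrangement.cocharPoly, ← Finset.sum_fiberwise_of_maps_to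
      (g := ToricArrangement.IntersectionLattice.dim) (t := Finset.range (d + 1))
      fun F _ => Finset.mem_range.2 (Nat.lt_succ_of_le F.dim_le)]
    refine Finset.sum_congr rfl fun i _ => ?_
    rw [hu.fNumber_eq, Nat.cast_sum, map_sum, Finset.sum_mul]
    refine Finset.sum_congr rfl fun F hF => ?_
    rw [hu.abs_mobius, hu.corank_eq_dim, (Finset.mem_filter.1 hF).2]
  · refine Finset.sum_congr rfl fun F _ => ?_
    rw [hu.corank_eq_dim, hu.abs_mobius, hu.mobius_eq, neg_pow (X : ℤ[X]), map_mul, map_pow, map_neg,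
      map_one]
    -- The sign of μ(F, 1̂) cancels the sign from (-X)^{dim F}.
    have : ((-1 : ℤ[X]) ^ F.dim) * (-1) ^ F.dim = 1 := by
      rw [← mul_pow, neg_one_mul, neg_neg, one_pow]
    linear_combination (-(C ((ToricArrangement.toricCellsOver F).ncard : ℤ)) * X ^ F.dim) * this
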